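/- \textbf{Proposition.} A signature $\sigma$ is a finite set of relation symbols with arities in $\mathbb{N}$. All structures over $\sigma$ have finite universes, and $M_{\mathbf D}=\max_{R\in\sigma}|R^{\mathbf D}|$. An SPJ plan over $\sigma$ is an expression built from the symbols of $\sigma$ by selections $\sigma_\theta$, projections $\pi_{j_1,\dots,j_n}$ ($n\ge 0$) and joins $\Join_\theta(p_1,\dots,p_\ell)$ ($\ell\ge 1$; the selection by $\theta$ of the product of the outputs), where $\theta$ is a set of identifications $j=k$ of positions; $\mathsf{out}(p,\mathbf D)$ is the relation computed by $p$ on $\mathbf D$. An open structure $(\mathbf A,\bar a)$ is a structure $\mathbf A$ in which every element occurs in some tuple of some relation, together with a tuple $\bar a$ of elements of $\mathbf A$. It is a $p$-representation if for every structure $\mathbf D$ over $\sigma$ one has $\mathsf{out}(p,\mathbf D)=\{h(\bar a) : h \text{ a homomorphism } \mathbf A\to\mathbf D\}$. A unary key $\mathrm{key}(R)=\{i\}$ is satisfied by a structure $\mathbf D$ if any two tuples of $R^{\mathbf D}$ that agree in position $i$ are equal. For a set $\Sigma$ of unary keys, a chase step on $(\mathbf A,\bar a)$ takes a key $\mathrm{key}(R)=\{i\}$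 in $\Sigma$ and two tuples of $R^{\mathbf A}$ that agree in position $i$ and have distinct entries $x,y$ in another position, and substitutes $y$ for $x$ throughout $\mathbf A$ and $\bar a$. The chase $\mathrm{Chase}_\Sigma(\mathbf A,\bar a)$ is the open structure obtained by repeating chase steps until none applies. A valid coloring of $\mathbf B$ with respect to $\Sigma$ is a map $\mathrm{Col}$ from the universe of $\mathbf B$ to the subsets of $\{1,\dots,k\}$, for some $k>0$, which is not constantly $\emptyset$, and such that for each key $\mathrm{key}(R)=\{i\}$ in $\Sigma$, each $(b_1,\dots,b_n)\in R^{\mathbf B}$ and each $j\neq i$ one has $\mathrm{Col}(b_j)\subseteq\mathrm{Col}(b_i)$. The color number of a set $S$ of elements of $\mathbf B$ is $$C_\Sigma^{\mathbf B}(S)=\max_{\mathrm{Col}}\ \frac{\bigl|\bigcup_{x\in S}\mathrm{Col}(x)\bigr|}{\max_{\bar t}\bigl|\bigcup_{x\in\bar t}\mathrm{Col}(x)\bigr|},$$ where $\mathrm{Col}$ ranges over all valid colorings and $\bar t$ over all tuples of all relations of $\mathbf B$. For $d\in\mathbb{Q}$, a plan $p$ has output degree $\le d$ (with respect to $\Sigma$)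 if there is $h:\mathbb N\to\mathbb N$ with $h(M)\in O(M^d)$ such that $|\mathsf{out}(p,\mathbf D)|\le h(M_{\mathbf D})$ for every structure $\mathbf D$ over $\sigma$ satisfying $\Sigma$. It has output degree $d$ if it has output degree $\le d$ but, for all $\epsilon>0$, does not have output degree $\le d-\epsilon$. Let $\Sigma$ be a set of unary keys over a signature $\sigma$, let $p$ be an SPJ plan over $\sigma$, let $(\mathbf A,\bar a)$ be a $p$-representation with nonempty universe, and let $\mathrm{Chase}_\Sigma(\mathbf A,\bar a)=(\mathbf B,\bar b)$. Then the maximum that defines $C_\Sigma^{\mathbf B}(\{\bar b\})$ exists, where $\{\bar b\}$ is the set of entries of $\bar b$, and $p$ has output degree $C_\Sigma^{\mathbf B}(\{\bar b\})$. -/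

import Mathlib

open FirstOrder Filter Asymptotics

universe u v

/-! ### Finite relational structures, open structures -/

/-- A structure with finite universe.  Signatures are relational first-order languages. -/
structure FinStr (L : FirstOrder.Language.{u, v}) where
  carrier : Type
  [str : L.Structure carrier]
  [fin : Finite carrier]

attribute [instance] FinStr.str FinStr.fin

/-- The relation `R^D`. -/
def FinStr.rel {L : FirstOrder.Language.{u, v}} (D : FinStr L) {n : ℕ} (R : L.Relations n) :
    Set (Fin n → D.carrier) :=
  {t | FirstOrder.Language.Structure.RelMap R t}

/-- The maximum size `M_D` of a relation of `D` (for a finite signature). -/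
noncomputable def FinStr.maxRelSize {L : FirstOrder.Language.{u, v}} (D : FinStr L) : ℕ :=
  ⨆ R : (Σ n, L.Relations n), (D.rel R.2).ncard

/-- An open structure `(A, ā)`: a finite structure `A` without isolated elements, together with
an `m`-tuple `ā` of elements of `A`. -/
structure OpenStr (L : FirstOrder.Language.{u, v}) (m : ℕ) extends FinStr L where
  tuple : Fin m → carrier
  no_isolated : ∀ x : carrier,
    ∃ (n : ℕ) (R : L.Relations n) (t : Fin n → carrier), t ∈ toFinStr.rel R ∧ x ∈ Set.range t

/-- `homs(A, ā, D)`, the set of the images `h(ā)` under homomorphisms `h` from `A` to `D`. -/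
def OpenStr.homs {L : FirstOrder.Language.{u, v}} {m : ℕ} (A : OpenStr L m) (D : FinStr L) :
    Set (Fin m → D.carrier) :=
  {t | ∃ h : A.carrier →[L] D.carrier, t = h ∘ A.tuple}

/-! ### Select-project-join plans -/

/-- SPJ plans over a signature, indexed by their arity.  An identification `j = k` is the pair
`(j, k)`, and positions are numbered from `0`. -/
inductive SPJPlan (L : FirstOrder.Language.{u, v}) : ℕ → Type v
  | basic {n : ℕ} (R : L.Relations n) : SPJPlan L n
  | select {m : ℕ} (θ : Set (Fin m × Fin m)) (p : SPJPlan L m) : SPJPlan L m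
  | project {m n : ℕ} (j : Fin n → Fin m) (p : SPJPlan L m) : SPJPlan L n
  | join {l : ℕ} (hl : 1 ≤ l) (m : Fin l → ℕ)
      (θ : Set (Fin (∑ i, m i) × Fin (∑ i, m i)))
      (p : ∀ i, SPJPlan L (m i)) : SPJPlan L (∑ i, m i)

/-- `σ_θ(Q)`. -/
def selectRel {α : Type} {m : ℕ} (θ : Set (Fin m × Fin m)) (Q : Set (Fin m → α)) :
    Set (Fin m → α) :=
  {d | d ∈ Q ∧ ∀ e ∈ θ, d e.1 = d e.2}

/-- `π_{j_1, …, j_n}(Q)`. -/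
def projectRel {α : Type} {m n : ℕ} (j : Fin n → Fin m) (Q : Set (Fin m → α)) :
    Set (Fin n → α) :=
  {t | ∃ d ∈ Q, t = d ∘ j}

/-- The product `Q_1 × ⋯ × Q_l`, whose tuples are the concatenations of tuples of the factors. -/
def productRel {α : Type} {l : ℕ} (m : Fin l → ℕ) (Q : ∀ i, Set (Fin (m i) → α)) :
    Set (Fin (∑ i, m i) → α) :=
  {t | ∀ i, (fun j : Fin (m i) => t (finSigmaFinEquiv ⟨i, j⟩)) ∈ Q i}

/-- The output `out(p, D)` of a plan over a structure. -/
def SPJPlan.out {L : FirstOrder.Language.{u, v}} (D : FinStr L) :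
    {m : ℕ} → SPJPlan L m → Set (Fin m → D.carrier)
  | _, .basic R => D.rel R
  | _, .select θ p => selectRel θ (p.out D)
  | _, .project j p => projectRel j (p.out D)
  | _, .join _ m θ p => selectRel θ (productRel m fun i => (p i).out D)

/-- `(A, ā)` is a `p`-representation. -/
def SPJPlan.IsRepresentation {L : FirstOrder.Language.{u, v}} {m : ℕ} (p : SPJPlan L m)
    (A : OpenStr L m) : Prop :=
  ∀ D : FinStr L, p.out D = A.homs D

/-! ### Key constraints and the chase -/

/-- A key constraint `key(R) = K`, with `R` of arity `n` and `K` a set of positions of `R`. -/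
structure KeyConstraint (L : FirstOrder.Language.{u, v}) where
  {n : ℕ}
  R : L.Relations n
  K : Finset (Fin n)

/-- A unary key: the set `K` of key positions is a singleton. -/
def KeyConstraint.IsUnary {L : FirstOrder.Language.{u, v}} (κ : KeyConstraint L) : Prop :=
  ∃ i, κ.K = {i}

/-- `D` satisfies every key in the set `Ks`. -/
def FinStr.Satisfies {L : FirstOrder.Language.{u, v}} (D : FinStr L) (Ks : Set (KeyConstraint L)) : Prop :=
  ∀ κ ∈ Ks, ∀ s ∈ D.rel κ.R, ∀ t ∈ D.rel κ.R, (∀ j ∈ κ.K, s j = t j) → s = t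

open Classical in
/-- The substitution `x ↦ y` of distinct elements, as a map onto the universe without `x`. -/
noncomputable def substMap {α : Type} (x y : α) (hxy : x ≠ y) (z : α) : {z : α // z ≠ x} :=
  if h : z = x then ⟨y, hxy.symm⟩ else ⟨z, h⟩

/-- The open structure obtained from `(A, ā)` by applying the substitution `x ↦ y` globally, to
the universe, to all tuples of all relations, and to `ā`. -/
noncomputable def OpenStr.subst {L : FirstOrder.Language.{u, v}} [L.IsRelational] {m : ℕ}
    (A : OpenStr L m) (x y : A.carrier) (hxy : x ≠ y) : OpenStr L m where
  carrier := {z : A.carrier // z ≠ x}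
  str :=
    { funMap := fun f => isEmptyElim f
      RelMap := fun R s => ∃ t ∈ A.rel R, s = substMap x y hxy ∘ t }
  tuple := substMap x y hxy ∘ A.tuple
  no_isolated := by
    intro z
    obtain ⟨n, R, t, ht, i, hi⟩ := A.no_isolated z.1
    refine ⟨n, R, substMap x y hxy ∘ t, ⟨t, ht, rfl⟩, i, ?_⟩
    simp [substMap, hi, z.2]

/-- One chase step: two tuples of a relation `R` agree on the positions of a key of `R` and have
distinct entries `x` and `y` at a position outside of the key; the substitution `x ↦ y` is
applied. -/
def ChaseStep {L : FirstOrder.Language.{u, v}} [L.IsRelational] {m : ℕ} (Ks : Set (KeyConstraint L))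
    (A B : OpenStr L m) : Prop :=
  ∃ κ ∈ Ks, ∃ s ∈ A.rel κ.R, ∃ t ∈ A.rel κ.R, (∀ j ∈ κ.K, s j = t j) ∧
    ∃ i, i ∉ κ.K ∧ ∃ h : s i ≠ t i, B = A.subst (s i) (t i) h

/-- `(B, b̄)` is a result of the chase of `(A, ā)`: it is reached by chase steps, and no further
chase step applies. -/
def IsChase {L : FirstOrder.Language.{u, v}} [L.IsRelational] {m : ℕ} (Ks : Set (KeyConstraint L))
    (A B : OpenStr L m) : Prop :=
  Relation.ReflTransGen (ChaseStep Ks) A B ∧ ¬ ∃ C, ChaseStep Ks B C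

/-! ### The color number -/

/-- Valid colorings of `B` with colors from a set of `k` colors. -/
def IsValidColoring {L : FirstOrder.Language.{u, v}} (Ks : Set (KeyConstraint L)) (B : FinStr L) {k : ℕ}
    (col : B.carrier → Finset (Fin k)) : Prop :=
  (∀ κ ∈ Ks, ∀ t ∈ B.rel κ.R, ∀ i, i ∉ κ.K → col (t i) ⊆ κ.K.biUnion fun j => col (t j)) ∧
    ∃ x, (col x).Nonempty

/-- The number of colors that a coloring assigns to the elements of `S`. -/
noncomputable def numColors {α : Type} {k : ℕ} (col : α → Finset (Fin k)) (S : Set α) : ℕ :=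
  (⋃ x ∈ S, (col x : Set (Fin k))).ncard

/-- The numbers of colors that a coloring assigns to the tuples of the relations of `B`. -/
def tupleColorCounts {L : FirstOrder.Language.{u, v}} (B : FinStr L) {k : ℕ}
    (col : B.carrier → Finset (Fin k)) : Set ℕ :=
  {c | ∃ (n : ℕ) (R : L.Relations n), ∃ t ∈ B.rel R, c = numColors col (Set.range t)}

/-- The ratios, over all valid colorings, of the number of colors of `S` to the maximum number of
colors of a tuple. -/
def colorRatios {L : FirstOrder.Language.{u, v}} (Ks : Set (KeyConstraint L)) (B : FinStr L)
    (S : Set B.carrier) : Set ℚ :=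
  {q | ∃ (k : ℕ) (col : B.carrier → Finset (Fin k)) (c : ℕ), 0 < k ∧ IsValidColoring Ks B col ∧
    IsGreatest (tupleColorCounts B col) c ∧ q = (numColors col S : ℚ) / (c : ℚ)}

/-- `d` is the color number of `S` with respect to `B` and `Ks`, that is, the maximal ratio. -/
def IsColorNumber {L : FirstOrder.Language.{u, v}} (Ks : Set (KeyConstraint L)) (B : FinStr L)
    (S : Set B.carrier) (d : ℚ) : Prop :=
  IsGreatest (colorRatios Ks B S) d

/-! ### The output degree -/

/-- The plan `p` has output degree `≤ d` (with respect to the keys `Ks`). -/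
def SPJPlan.HasOutputDegreeLE {L : FirstOrder.Language.{u, v}} {m : ℕ} (Ks : Set (KeyConstraint L))
    (p : SPJPlan L m) (d : ℚ) : Prop :=
  ∃ h : ℕ → ℕ, ((fun M : ℕ => (h M : ℝ)) =O[atTop] fun M : ℕ => (M : ℝ) ^ (d : ℝ)) ∧
    ∀ D : FinStr L, D.Satisfies Ks → (p.out D).ncard ≤ h D.maxRelSize

/-- The plan `p` has output degree `d` (with respect to the keys `Ks`). -/
def SPJPlan.HasOutputDegree {L : FirstOrder.Language.{u, v}} {m : ℕ} (Ks : Set (KeyConstraint L))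
    (p : SPJPlan L m) (d : ℚ) : Prop :=
  p.HasOutputDegreeLE Ks d ∧ ∀ ε : ℚ, 0 < ε → ¬ p.HasOutputDegreeLE Ks (d - ε)

/-! Homomorphisms into a structure satisfying the keys cannot see chase steps, so on such structures
`p` computes the images of the tuple of `B`. Both the degree and the color number are then compared
with one linear program: the maximal total weight of a fractional packing of the output positions,
where the positions determined by any single tuple of `B` weigh at most 1.

Upper bound (`OpenStr.ncard_homs_le`): draw an output tuple uniformly and weigh each position by its
conditional entropy given the earlier ones. The total is the log of the output size. By
submodularity, the positions determined by a tuple of `R` weigh at most their joint entropy, hence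
at most `log |R^D|`. Dividing by `log M` gives a packing.

Color number (`OpenStr.isColorNumber_of_max_packing`): a coloring becomes a packing by charging each
output color to one position. Conversely, an optimal rational packing, with denominators cleared,
gives each position private colors, which every element determining it inherits.

Lower bound: an optimal coloring turns `B` into structures (`FinStr.coloredPower`) whose elements
carry values for their colors. Relations then have order `n ^ c` tuples, with `c` the largest number
of colors on a tuple, while the output has at least `n` to the number of its colors. -/

/-! ### Rational optima of fractional packing. -/

/-- Finitely many reals are approximated by their images under a `ℚ`-linear retraction onto `ℚ`. -/
theorem exists_rat_linear_approx {ι : Type*} [Fintype ι] (w : ι → ℝ) {ε : ℝ} (hε : 0 < ε) :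
    ∃ φ : ℝ →ₗ[ℚ] ℚ, φ 1 = 1 ∧ ∀ i, |(φ (w i) : ℝ) - w i| < ε := by
  classical
  have hli : LinearIndepOn ℚ id ({1} : Set ℝ) := LinearIndepOn.singleton (v := id) one_ne_zero
  let b := Module.Basis.extend hli
  obtain ⟨j₁, hj₁⟩ : ∃ j, b j = 1 := by
    have h1 : (1 : ℝ) ∈ Set.range b := by
      rw [Module.Basis.range_extend]
      exact Module.Basis.subset_extend hli rfl
    exact h1
  set S : ℝ := ∑ i, ∑ j ∈ (b.repr (w i)).support, |((b.repr (w i) j : ℚ) : ℝ)| with hS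
  have hS0 : 0 ≤ S := Finset.sum_nonneg fun i _ => Finset.sum_nonneg fun j _ => abs_nonneg _
  have hδ : 0 < ε / (S + 1) := by positivity
  have hq : ∀ j, ∃ q : ℚ, |(q : ℝ) - b j| < ε / (S + 1) := fun j => by
    obtain ⟨q, h1, h2⟩ := exists_rat_btwn (show b j < b j + ε / (S + 1) by linarith)
    exact ⟨q, by rw [abs_lt]; constructor <;> linarith⟩
  choose q hq using hq
  -- On a `ℚ`-basis of `ℝ` containing 1, `φ` fixes 1 and moves every other basis vector to a nearby
  -- rational; `S` bounds the coefficients, hence the error.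
  refine ⟨b.constr ℚ fun j => if j = j₁ then 1 else q j, ?_, fun i => ?_⟩
  · have h := b.constr_basis ℚ (fun j => if j = j₁ then (1 : ℚ) else q j) j₁
    rwa [hj₁, if_pos rfl] at h
  · set r : _ → ℚ := fun j => if j = j₁ then 1 else q j with hr
    have hrq : ∀ j, |(r j : ℝ) - b j| ≤ ε / (S + 1) := fun j => by
      by_cases h : j = j₁
      · simp [hr, h, hj₁, hδ.le]
      · simp only [hr, h, if_false]; exact (hq j).le
    have h1 : (((b.constr ℚ r) (w i) : ℚ) : ℝ)
        = ∑ j ∈ (b.repr (w i)).support, ((b.repr (w i) j : ℚ) : ℝ) * r j := by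
      rw [Module.Basis.constr_apply, Finsupp.sum]
      push_cast [smul_eq_mul]; rfl
    have h2 : w i = ∑ j ∈ (b.repr (w i)).support, ((b.repr (w i) j : ℚ) : ℝ) * b j := by
      conv_lhs => rw [← b.linearCombination_repr (w i), Finsupp.linearCombination_apply, Finsupp.sum]
      simp [Rat.smul_def]
    have h3 : |(((b.constr ℚ r) (w i) : ℚ) : ℝ) - w i|
        ≤ (∑ j ∈ (b.repr (w i)).support, |((b.repr (w i) j : ℚ) : ℝ)|) * (ε / (S + 1)) := by
      conv_lhs => rw [h1]; arg 1; arg 2; rw [h2]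
      rw [← Finset.sum_sub_distrib, Finset.sum_mul]
      refine (Finset.abs_sum_le_sum_abs _ _).trans (Finset.sum_le_sum fun j _ => ?_)
      rw [← mul_sub, abs_mul]
      exact mul_le_mul_of_nonneg_left (hrq j) (abs_nonneg _)
    have h4 : (∑ j ∈ (b.repr (w i)).support, |((b.repr (w i) j : ℚ) : ℝ)|) ≤ S :=
      Finset.single_le_sum
        (f := fun i => ∑ j ∈ (b.repr (w i)).support, |((b.repr (w i) j : ℚ) : ℝ)|)
        (fun i _ => Finset.sum_nonneg fun j _ => abs_nonneg _) (Finset.mem_univ i)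
    calc _ ≤ _ := h3
      _ ≤ S * (ε / (S + 1)) := mul_le_mul_of_nonneg_right h4 hδ.le
      _ < (S + 1) * (ε / (S + 1)) := mul_lt_mul_of_pos_right (by linarith) hδ
      _ = ε := by field_simp

/-- A fractional packing with respect to a family of sets: a nonnegative weighting of total weight
at most one on each of the sets. -/
def IsFractionalPacking {ι : Type*} (F : Set (Finset ι)) (w : ι → ℝ) : Prop :=
  (∀ i, 0 ≤ w i) ∧ ∀ I ∈ F, ∑ i ∈ I, w i ≤ 1

/-- Every index lies in some member of `F`, so the packings form a closed subset of the unit cube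
and compactness applies. -/
theorem exists_max_fractionalPacking {ι : Type*} [Fintype ι] (F : Set (Finset ι))
    (hF : ∀ i, ∃ I ∈ F, i ∈ I) :
    ∃ w, IsFractionalPacking F w ∧ ∀ w', IsFractionalPacking F w' → ∑ i, w' i ≤ ∑ i, w i := by
  have hsub : {w | IsFractionalPacking F w} ⊆ Set.Icc (0 : ι → ℝ) 1 := by
    rintro w ⟨h0, h1⟩
    refine ⟨h0, fun i => ?_⟩
    obtain ⟨I, hI, hi⟩ := hF i
    exact (Finset.single_le_sum (fun j _ => h0 j) hi).trans (h1 I hI)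
  have hclosed : IsClosed {w | IsFractionalPacking F w} := by
    simp only [IsFractionalPacking, Set.ofPred_and, Set.ofPred_forall]
    refine IsClosed.inter (isClosed_iInter fun i => isClosed_le (by fun_prop) (by fun_prop))
      (isClosed_iInter fun I => isClosed_iInter fun _ => isClosed_le (by fun_prop) (by fun_prop))
  have hcomp : IsCompact {w | IsFractionalPacking F w} := isCompact_Icc.of_isClosed_subset hclosed hsub
  obtain ⟨w, hw, hmax⟩ := hcomp.exists_isMaxOn (f := fun w => ∑ i, w i)
    ⟨0, fun _ => le_rfl, fun I _ => by simp⟩ (by fun_prop)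
  exact ⟨w, hw, fun w' hw' => hmax hw'⟩

/-- The maximum total weight of a fractional packing is attained by a rational packing. -/
theorem exists_rat_max_fractionalPacking {ι : Type*} [Fintype ι] (F : Set (Finset ι))
    (hF : ∀ i, ∃ I ∈ F, i ∈ I) :
    ∃ q : ι → ℚ, IsFractionalPacking F (fun i => (q i : ℝ)) ∧
      ∀ w, IsFractionalPacking F w → ∑ i, w i ≤ ((∑ i, q i : ℚ) : ℝ) := by
  obtain ⟨w, ⟨hw0, hw1⟩, hmax⟩ := exists_max_fractionalPacking F hF
  -- Constraints that are strict at `w` survive for any nearby `w'` and for its reflection `2 * w -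
  -- w'`.
  have hev : ∀ᶠ w' in nhds w, (∀ i, 0 < w i → 0 < w' i ∧ 0 < 2 * w i - w' i) ∧
      ∀ I : Finset ι, ∑ i ∈ I, w i < 1 →
        ∑ i ∈ I, w' i < 1 ∧ ∑ i ∈ I, (2 * w i - w' i) < 1 := by
    refine (eventually_all.2 fun i => ?_).and (eventually_all.2 fun I => ?_)
    · by_cases h : 0 < w i
      · have h1 : ∀ᶠ w' in nhds w, 0 < w' i :=
          (continuous_apply i).continuousAt.eventually (lt_mem_nhds h)
        have h2 : ∀ᶠ w' in nhds w, 0 < 2 * w i - w' i := by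
          have : Continuous fun w' : ι → ℝ => 2 * w i - w' i := by fun_prop
          exact this.continuousAt.eventually (lt_mem_nhds (by linarith))
        filter_upwards [h1, h2] with w' a b _ using ⟨a, b⟩
      · exact Eventually.of_forall fun _ h' => absurd h' h
    · by_cases h : ∑ i ∈ I, w i < 1
      · have h1 : ∀ᶠ w' in nhds w, ∑ i ∈ I, w' i < 1 := by
          have : Continuous fun w' : ι → ℝ => ∑ i ∈ I, w' i := by fun_prop
          exact this.continuousAt.eventually (gt_mem_nhds h)
        have h2 : ∀ᶠ w' in nhds w, ∑ i ∈ I, (2 * w i - w' i) < 1 := by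
          have : Continuous fun w' : ι → ℝ => ∑ i ∈ I, (2 * w i - w' i) := by fun_prop
          refine this.continuousAt.eventually (gt_mem_nhds ?_)
          simpa only [two_mul, add_sub_cancel_right] using h
        filter_upwards [h1, h2] with w' a b _ using ⟨a, b⟩
      · exact Eventually.of_forall fun _ h' => absurd h' h
  obtain ⟨ε, hε, hball⟩ := Metric.eventually_nhds_iff.1 hev
  obtain ⟨φ, hφ1, hφ⟩ := exists_rat_linear_approx w hε
  obtain ⟨hp, hs⟩ := hball (y := fun i => (φ (w i) : ℝ))
    ((dist_pi_lt_iff hε).2 fun i => by rw [Real.dist_eq]; exact hφ i)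
  -- Tight constraints survive exactly, since `φ` is additive and fixes 1.
  have hsum : ∀ I : Finset ι, ∑ i ∈ I, w i = 1 → ∑ i ∈ I, (φ (w i) : ℝ) = 1 := fun I hI => by
    rw [← Rat.cast_sum, ← map_sum, hI, hφ1, Rat.cast_one]
  have hq : IsFractionalPacking F fun i => (φ (w i) : ℝ) := by
    refine ⟨fun i => ?_, fun I hI => ?_⟩
    · rcases (hw0 i).lt_or_eq with h | h
      · exact (hp i h).1.le
      · simp [← h]
    · rcases (hw1 I hI).lt_or_eq with h | h
      · exact (hs I h).1.le
      · exact (hsum I h).le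
  have hq' : IsFractionalPacking F fun i => 2 * w i - (φ (w i) : ℝ) := by
    refine ⟨fun i => ?_, fun I hI => ?_⟩
    · rcases (hw0 i).lt_or_eq with h | h
      · exact (hp i h).2.le
      · simp [← h]
    · rcases (hw1 I hI).lt_or_eq with h | h
      · exact (hs I h).2.le
      · rw [Finset.sum_sub_distrib, ← Finset.mul_sum, hsum I h, h]; norm_num
  refine ⟨fun i => φ (w i), hq, fun w' hw' => (hmax w' hw').trans ?_⟩
  -- The reflected packing weighs at most as much as `w`, so the rational one weighs at least as
  -- much.
  have := hmax _ hq'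
  rw [Finset.sum_sub_distrib, ← Finset.mul_sum] at this
  push_cast
  linarith

/-! ### Entropy of a finite set of tuples -/

section Entropy

variable {Ω ι α : Type*} [Fintype Ω] (X : ι → Ω → α)

open Classical in
/-- The number of points that agree with `ω` on the coordinates in `U`. -/
noncomputable def agreeCount (U : Finset ι) (ω : Ω) : ℕ :=
  (Finset.univ.filter fun ω' => ∀ i ∈ U, X i ω' = X i ω).card

/-- The entropy of the coordinates in `U`, for the uniform distribution. -/
noncomputable def coordEntropy (U : Finset ι) : ℝ :=
  (∑ ω : Ω, Real.log (Fintype.card Ω / agreeCount X U ω)) / Fintype.card Ω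

theorem agreeCount_pos (U : Finset ι) (ω : Ω) : 0 < agreeCount X U ω :=
  Finset.card_pos.2 ⟨ω, by simp⟩

theorem agreeCount_eq {U : Finset ι} {ω ω' : Ω} (h : ∀ i ∈ U, X i ω' = X i ω) :
    agreeCount X U ω' = agreeCount X U ω := by
  unfold agreeCount
  congr 1
  ext η
  simp only [Finset.mem_filter, Finset.mem_univ, true_and]
  exact ⟨fun H i hi => (H i hi).trans (h i hi), fun H i hi => (H i hi).trans (h i hi).symm⟩

theorem agreeCount_anti {U V : Finset ι} (h : V ⊆ U) (ω : Ω) :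
    agreeCount X U ω ≤ agreeCount X V ω := by
  refine Finset.card_le_card fun η => ?_
  simp only [Finset.mem_filter, Finset.mem_univ, true_and]
  exact fun H i hi => H i (h hi)

theorem coordEntropy_empty [Nonempty Ω] : coordEntropy X ∅ = 0 := by
  simp [coordEntropy, agreeCount]

theorem coordEntropy_mono {U V : Finset ι} (h : V ⊆ U) : coordEntropy X V ≤ coordEntropy X U := by
  unfold coordEntropy
  refine div_le_div_of_nonneg_right (Finset.sum_le_sum fun ω _ => ?_) (Nat.cast_nonneg _)
  have h1 := agreeCount_pos X U ω
  have h2 := agreeCount_pos X V ω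
  have h3 : 0 < Fintype.card Ω := Fintype.card_pos_iff.2 ⟨ω⟩
  refine Real.log_le_log (by positivity) ?_
  have := agreeCount_anti X h ω
  gcongr

theorem coordEntropy_eq_log_card [Nonempty Ω] {U : Finset ι}
    (h : ∀ ω ω' : Ω, (∀ i ∈ U, X i ω' = X i ω) → ω' = ω) :
    coordEntropy X U = Real.log (Fintype.card Ω) := by
  classical
  have h1 : ∀ ω, agreeCount X U ω = 1 := fun ω => by
    unfold agreeCount
    rw [Finset.card_eq_one]
    refine ⟨ω, ?_⟩
    ext η
    simp only [Finset.mem_filter, Finset.mem_univ, true_and, Finset.mem_singleton]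
    exact ⟨h ω η, fun e => by simp [e]⟩
  have : (Fintype.card Ω : ℝ) ≠ 0 := by simp
  simp only [coordEntropy, h1, Nat.cast_one, div_one, Finset.sum_const, Finset.card_univ,
    nsmul_eq_mul]
  field_simp

/-- A fibre of `g` lies inside one agreement class, where each summand is the inverse of the class
size; so each fibre contributes at most 1. -/
theorem sum_inv_agreeCount_le {β : Type*} {U : Finset ι} (g : Ω → β) (T : Finset β)
    (hT : ∀ ω, g ω ∈ T) (hg : ∀ ω ω', g ω = g ω' → ∀ i ∈ U, X i ω = X i ω') :
    ∑ ω : Ω, (agreeCount X U ω : ℝ)⁻¹ ≤ T.card := by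
  classical
  rw [← Finset.sum_fiberwise_of_maps_to (t := T) (g := g) fun ω _ => hT ω,
    Finset.card_eq_sum_ones, Nat.cast_sum]
  refine Finset.sum_le_sum fun y _ => ?_
  rcases (Finset.univ.filter fun ω => g ω = y).eq_empty_or_nonempty with h | ⟨ω₀, h₀⟩
  · simp [h]
  · have h₀' : g ω₀ = y := by simpa using h₀
    have hpos := agreeCount_pos X U ω₀
    rw [Finset.sum_congr rfl (g := fun _ => (agreeCount X U ω₀ : ℝ)⁻¹)]
    · rw [Finset.sum_const, nsmul_eq_mul, Nat.cast_one, ← div_eq_mul_inv,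
        div_le_one (by exact_mod_cast hpos)]
      refine Nat.cast_le.2 (Finset.card_le_card fun η hη => ?_)
      simp only [Finset.mem_filter, Finset.mem_univ, true_and] at hη ⊢
      exact hg _ _ (hη.trans h₀'.symm)
    · intro η hη
      rw [agreeCount_eq X (hg η ω₀ ?_)]
      simp only [Finset.mem_filter, Finset.mem_univ, true_and] at hη
      exact hη.trans h₀'.symm

/-- Jensen's inequality in the form `log x ≤ x - 1`, applied after factoring out `T.card`. -/
theorem coordEntropy_le_log_card [Nonempty Ω] {β : Type*} {U : Finset ι} (g : Ω → β) (T : Finset β)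
    (hT : ∀ ω, g ω ∈ T) (hg : ∀ ω ω', g ω = g ω' → ∀ i ∈ U, X i ω = X i ω') :
    coordEntropy X U ≤ Real.log T.card := by
  have hN : (0 : ℝ) < Fintype.card Ω := by exact_mod_cast Fintype.card_pos
  have hm : (0 : ℝ) < T.card := by
    obtain ⟨ω⟩ := ‹Nonempty Ω›
    exact_mod_cast Finset.card_pos.2 ⟨g ω, hT ω⟩
  unfold coordEntropy
  rw [div_le_iff₀ hN]
  have h1 : ∀ ω : Ω, Real.log (Fintype.card Ω / agreeCount X U ω)
      ≤ Real.log T.card + (Fintype.card Ω / T.card * (agreeCount X U ω : ℝ)⁻¹ - 1) := fun ω => by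
    have hc : (0 : ℝ) < agreeCount X U ω := by exact_mod_cast agreeCount_pos X U ω
    have := Real.log_le_sub_one_of_pos
      (show 0 < Fintype.card Ω / T.card * (agreeCount X U ω : ℝ)⁻¹ by positivity)
    have h2 : (Fintype.card Ω / agreeCount X U ω : ℝ)
      = T.card * (Fintype.card Ω / T.card * (agreeCount X U ω : ℝ)⁻¹) := by field_simp
    rw [h2, Real.log_mul hm.ne' (by positivity)]
    linarith
  refine (Finset.sum_le_sum fun ω _ => h1 ω).trans ?_
  rw [Finset.sum_add_distrib, Finset.sum_sub_distrib, ← Finset.mul_sum]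
  simp only [Finset.sum_const, Finset.card_univ, nsmul_eq_mul, mul_one]
  have h3 := mul_le_mul_of_nonneg_left (sum_inv_agreeCount_le X g T hT hg)
    (show (0 : ℝ) ≤ Fintype.card Ω / T.card by positivity)
  rw [div_mul_cancel₀ _ hm.ne'] at h3
  linarith

/-- Write the numerator as a count of pairs `(η, ζ)` agreeing with `ω` on `U` and on `insert a V`.
For a fixed pair, all such `ω` lie in one class for `insert a U`, which cancels that factor and
leaves the inverse class size of `η` for `V`. Summing over `ζ` gives 1 for each `η`. -/
theorem sum_agreeCount_ratio_le [DecidableEq ι] {U V : Finset ι} (h : V ⊆ U) (a : ι) :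
    ∑ ω : Ω, (agreeCount X U ω * agreeCount X (insert a V) ω : ℝ) /
      (agreeCount X (insert a U) ω * agreeCount X V ω) ≤ Fintype.card Ω := by
  classical
  have hpos : ∀ W ω, (0 : ℝ) < agreeCount X W ω := fun W ω => by
    exact_mod_cast agreeCount_pos X W ω
  have e : ∀ W ω, (agreeCount X W ω : ℝ) = ∑ η, if ∀ i ∈ W, X i η = X i ω then 1 else 0 :=
    fun W ω => by simp [agreeCount]
  have key : ∀ η ζ : Ω, ∑ ω, ((if ∀ i ∈ U, X i η = X i ω then (1 : ℝ) else 0) *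
      (if ∀ i ∈ insert a V, X i ζ = X i ω then 1 else 0)) /
      (agreeCount X (insert a U) ω * agreeCount X V ω) ≤
      (if ∀ i ∈ V, X i ζ = X i η then 1 else 0) / agreeCount X V η := by
    intro η ζ
    simp only [← ite_and, ite_div, zero_div, mul_ite, mul_one, mul_zero]
    by_cases hex : ∃ ω₀, (∀ i ∈ insert a V, X i ζ = X i ω₀) ∧ ∀ i ∈ U, X i η = X i ω₀
    · obtain ⟨ω₀, hz, hη⟩ := hex
      have hV : ∀ i ∈ V, X i ζ = X i η := fun i hi =>
        (hz i (Finset.mem_insert_of_mem hi)).trans (hη i (h hi)).symm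
      rw [if_pos hV, ← Finset.sum_filter]
      have hag : ∀ ω, ((∀ i ∈ insert a V, X i ζ = X i ω) ∧ ∀ i ∈ U, X i η = X i ω) →
          ∀ i ∈ insert a U, X i ω = X i ω₀ := by
        rintro ω ⟨h1, h2⟩ i hi
        rcases Finset.mem_insert.1 hi with rfl | hi
        · exact (h1 i (Finset.mem_insert_self _ _)).symm.trans (hz i (Finset.mem_insert_self _ _))
        · exact (h2 i hi).symm.trans (hη i hi)
      rw [Finset.sum_congr rfl (g := fun _ => (1 : ℝ) / (agreeCount X (insert a U) ω₀ *
        agreeCount X V η))]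
      · rw [Finset.sum_const, nsmul_eq_mul]
        have hcard : ((Finset.univ.filter fun ω => (∀ i ∈ insert a V, X i ζ = X i ω) ∧
            ∀ i ∈ U, X i η = X i ω).card : ℝ) ≤ agreeCount X (insert a U) ω₀ := by
          refine Nat.cast_le.2 (Finset.card_le_card fun ω hω => ?_)
          simp only [Finset.mem_filter, Finset.mem_univ, true_and] at hω ⊢
          exact hag ω hω
        have p1 := hpos (insert a U) ω₀
        have p2 := hpos V η
        rw [mul_one_div, div_le_div_iff₀ (by positivity) p2]
        nlinarith [mul_le_mul_of_nonneg_right hcard p2.le]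
      · intro ω hω
        simp only [Finset.mem_filter, Finset.mem_univ, true_and] at hω
        rw [agreeCount_eq X (hag ω hω),
          agreeCount_eq X (U := V) (ω' := ω) (ω := η) fun i hi => (hω.2 i (h hi)).symm]
    · rw [Finset.sum_eq_zero]
      · have := hpos V η
        split_ifs <;> positivity
      · intro ω _
        rw [if_neg]
        exact fun H => hex ⟨ω, H⟩
  calc _ = ∑ ω : Ω, ∑ η, ∑ ζ, ((if ∀ i ∈ U, X i η = X i ω then (1 : ℝ) else 0) *
      (if ∀ i ∈ insert a V, X i ζ = X i ω then 1 else 0)) /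
      (agreeCount X (insert a U) ω * agreeCount X V ω) := by
        refine Finset.sum_congr rfl fun ω _ => ?_
        rw [e U ω, e (insert a V) ω, Finset.sum_mul_sum, Finset.sum_div]
        exact Finset.sum_congr rfl fun η _ => Finset.sum_div _ _ _
    _ = ∑ η, ∑ ζ, ∑ ω : Ω, ((if ∀ i ∈ U, X i η = X i ω then (1 : ℝ) else 0) *
      (if ∀ i ∈ insert a V, X i ζ = X i ω then 1 else 0)) /
      (agreeCount X (insert a U) ω * agreeCount X V ω) := by
        rw [Finset.sum_comm]
        exact Finset.sum_congr rfl fun η _ => Finset.sum_comm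
    _ ≤ ∑ η, ∑ ζ, (if ∀ i ∈ V, X i ζ = X i η then (1 : ℝ) else 0) / agreeCount X V η :=
        Finset.sum_le_sum fun η _ => Finset.sum_le_sum fun ζ _ => key η ζ
    _ = ∑ η : Ω, 1 := by
        refine Finset.sum_congr rfl fun η _ => ?_
        rw [← Finset.sum_div, ← e, div_self (hpos V η).ne']
    _ = _ := by simp

/-- Conditioning on more coordinates lowers entropy: bound the log of the ratio in
`sum_agreeCount_ratio_le` by the ratio minus 1. -/
theorem coordEntropy_submodular [Nonempty Ω] [DecidableEq ι] {U V : Finset ι} (h : V ⊆ U) (a : ι) :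
    coordEntropy X (insert a U) - coordEntropy X U ≤
      coordEntropy X (insert a V) - coordEntropy X V := by
  have hN : (0 : ℝ) < Fintype.card Ω := by exact_mod_cast Fintype.card_pos
  have hpos : ∀ W ω, (0 : ℝ) < agreeCount X W ω := fun W ω => by
    exact_mod_cast agreeCount_pos X W ω
  unfold coordEntropy
  rw [← sub_div, ← sub_div]
  refine div_le_div_of_nonneg_right ?_ hN.le
  rw [← sub_nonpos, ← Finset.sum_sub_distrib, ← Finset.sum_sub_distrib, ← Finset.sum_sub_distrib]
  have h1 := sum_agreeCount_ratio_le X h a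
  calc _ ≤ ∑ ω : Ω, ((agreeCount X U ω * agreeCount X (insert a V) ω : ℝ) /
      (agreeCount X (insert a U) ω * agreeCount X V ω) - 1) := by
        refine Finset.sum_le_sum fun ω _ => ?_
        have p1 := hpos U ω
        have p2 := hpos V ω
        have p3 := hpos (insert a U) ω
        have p4 := hpos (insert a V) ω
        refine le_trans (le_of_eq ?_) (Real.log_le_sub_one_of_pos (by positivity))
        rw [Real.log_div hN.ne' p3.ne', Real.log_div hN.ne' p1.ne', Real.log_div hN.ne' p4.ne',
          Real.log_div hN.ne' p2.ne', Real.log_div (by positivity) (by positivity),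
          Real.log_mul p1.ne' p4.ne', Real.log_mul p3.ne' p2.ne']
        ring
    _ ≤ 0 := by
        rw [Finset.sum_sub_distrib]
        simpa using h1

end Entropy

/-- The conditional entropies of the coordinates, given the preceding ones, are weights of total
`log |Ω|` for which every set of coordinates weighs at most its entropy. -/
theorem exists_entropy_weights {Ω α : Type*} [Fintype Ω] [Nonempty Ω] {m : ℕ} (X : Fin m → Ω → α)
    (hX : ∀ ω ω' : Ω, (∀ i, X i ω' = X i ω) → ω' = ω) :
    ∃ w : Fin m → ℝ, (∀ i, 0 ≤ w i) ∧ ∑ i, w i = Real.log (Fintype.card Ω) ∧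
      ∀ I, ∑ i ∈ I, w i ≤ coordEntropy X I := by
  let J : ℕ → Finset (Fin m) := fun n => Finset.univ.filter fun i => i.val < n
  have hJ : ∀ i : Fin m, J (i + 1) = insert i (J i) := fun i => by
    ext j
    simp only [J, Finset.mem_filter, Finset.mem_univ, true_and, Finset.mem_insert, Fin.ext_iff]
    omega
  refine ⟨fun i => coordEntropy X (J (i + 1)) - coordEntropy X (J i), fun i => ?_, ?_, fun I => ?_⟩
  · simp only [hJ]
    exact sub_nonneg.2 (coordEntropy_mono X (Finset.subset_insert _ _))
  · rw [Fin.sum_univ_eq_sum_range (fun n => coordEntropy X (J (n + 1)) - coordEntropy X (J n)),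
      Finset.sum_range_sub (fun n => coordEntropy X (J n))]
    have h0 : J 0 = ∅ := by simp [J]
    have hm : J m = Finset.univ := by simp [J]
    rw [h0, hm, coordEntropy_empty, sub_zero]
    exact coordEntropy_eq_log_card X fun ω ω' h => hX ω ω' fun i => h i (Finset.mem_univ i)
  -- Adding the largest element `a` to `s ⊆ J a` raises the entropy at least as much as adding it to
  -- `J a`, which is the weight of `a`.
  · induction I using Finset.induction_on_max with
    | empty => simp [coordEntropy_empty]
    | insert a s hs ih =>
      rw [Finset.sum_insert fun h => lt_irrefl _ (hs a h), hJ]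
      have : s ⊆ J a := fun j hj => by simpa [J] using hs j hj
      have := coordEntropy_submodular X this a
      linarith

/-! ### Invariance of homomorphic images under the chase. -/

section Chase

variable {L : FirstOrder.Language.{u, v}} [L.IsRelational] {m : ℕ} {Ks : Set (KeyConstraint L)}

theorem substMap_of_ne {α : Type} {x y z : α} (hxy : x ≠ y) (h : z ≠ x) :
    (substMap x y hxy z : α) = z := by
  simp [substMap, h]

theorem substMap_self {α : Type} {x y : α} (hxy : x ≠ y) : (substMap x y hxy x : α) = y := by
  simp [substMap]

/-- A chase step does not change the image tuples over structures that satisfy the keys. -/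
theorem ChaseStep.homs_eq {A B : OpenStr L m} (h : ChaseStep Ks A B) {D : FinStr L}
    (hD : D.Satisfies Ks) : A.homs D = B.homs D := by
  obtain ⟨κ, hκ, s, hs, t, ht, hst, i, -, hne, rfl⟩ := h
  ext d
  constructor
  · rintro ⟨f, rfl⟩
    -- The key in `D` makes `f` identify the two entries, so `f` factors through the substitution.
    have hf : f (s i) = f (t i) := by
      have := hD κ hκ (f ∘ s) (f.map_rel' κ.R s hs) (f ∘ t) (f.map_rel' κ.R t ht)
        fun j hj => congrArg f (hst j hj)
      exact congrFun this i
    have key : ∀ z, f (substMap (s i) (t i) hne z : A.carrier) = f z := fun z => by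
      by_cases hz : z = s i
      · rw [hz, substMap_self, hf]
      · rw [substMap_of_ne hne hz]
    refine ⟨⟨fun z => f z.1, fun g => isEmptyElim g, ?_⟩, ?_⟩
    · rintro n R r ⟨r', hr', rfl⟩
      have : (fun z : {z : A.carrier // z ≠ s i} => f z.1) ∘ substMap (s i) (t i) hne ∘ r'
          = f ∘ r' := funext fun j => key (r' j)
      change D.str.RelMap R ((fun z : {z : A.carrier // z ≠ s i} => f z.1) ∘ _)
      rw [this]
      exact f.map_rel' R r' hr'
    · exact funext fun j => (key (A.tuple j)).symm
  · rintro ⟨f, rfl⟩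
    exact ⟨⟨fun z => f (substMap (s i) (t i) hne z), fun g => isEmptyElim g,
      fun R r hr => f.map_rel' R _ ⟨r, hr, rfl⟩⟩, rfl⟩

theorem IsChase.homs_eq {A B : OpenStr L m} (h : IsChase Ks A B) {D : FinStr L}
    (hD : D.Satisfies Ks) : A.homs D = B.homs D := by
  obtain ⟨h, -⟩ := h
  induction h with
  | refl => rfl
  | tail _ hs ih => exact ih.trans (hs.homs_eq hD)

theorem IsChase.satisfies {A B : OpenStr L m} (h : IsChase Ks A B) : B.Satisfies Ks := by
  intro κ hκ s hs t ht hst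
  by_contra hne
  obtain ⟨i, hi⟩ := Function.ne_iff.1 hne
  exact h.2 ⟨_, κ, hκ, s, hs, t, ht, hst, i, fun hiK => hi (hst i hiK), hi, rfl⟩

theorem IsChase.nonempty {A B : OpenStr L m} (h : IsChase Ks A B) (hA : Nonempty A.carrier) :
    Nonempty B.carrier := by
  obtain ⟨h, -⟩ := h
  induction h with
  | refl => exact hA
  | tail _ hs ih =>
    obtain ⟨κ, hκ, s, hs, t, ht, hst, i, -, hne, rfl⟩ := hs
    exact ⟨⟨t i, hne.symm⟩⟩

end Chase

/-! ### Functional determination and the entropy bound. -/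

section Determination

variable {L : FirstOrder.Language.{u, v}} {Ks : Set (KeyConstraint L)}

/-- Some tuple has the element `x` at the position of a unary key and contains the element `y`. -/
def FinStr.Determines (Ks : Set (KeyConstraint L)) (B : FinStr L) (x y : B.carrier) : Prop :=
  ∃ κ ∈ Ks, ∃ t ∈ B.rel κ.R, ∃ i j, κ.K = {i} ∧ x = t i ∧ y = t j

/-- The elements determined by the entries of a tuple, in any number of steps. -/
def FinStr.determinedBy (Ks : Set (KeyConstraint L)) (B : FinStr L) {n : ℕ}
    (t : Fin n → B.carrier) : Set B.carrier :=
  {y | ∃ i, Relation.ReflTransGen (B.Determines Ks) (t i) y}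

/-- The images of a tuple under `f` and `g` coincide once they agree at the key position, and this
propagates along chains. -/
theorem FinStr.Determines.hom_eq {B D : FinStr L} (hD : D.Satisfies Ks) {x y : B.carrier}
    (h : Relation.ReflTransGen (B.Determines Ks) x y) (f g : B.carrier →[L] D.carrier)
    (hfg : f x = g x) : f y = g y := by
  induction h with
  | refl => exact hfg
  | tail _ hs ih =>
    obtain ⟨κ, hκ, t, ht, i, j, hK, rfl, rfl⟩ := hs
    have := hD κ hκ (f ∘ t) (f.map_rel' κ.R t ht) (g ∘ t) (g.map_rel' κ.R t ht) fun j hj => by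
      rw [hK, Finset.mem_singleton] at hj
      rw [hj]
      exact ih
    exact congrFun this j

theorem IsValidColoring.subset {B : FinStr L} {k : ℕ} {col : B.carrier → Finset (Fin k)}
    (hcol : IsValidColoring Ks B col) {x y : B.carrier}
    (h : Relation.ReflTransGen (B.Determines Ks) x y) : col y ⊆ col x := by
  induction h with
  | refl => exact subset_rfl
  | tail _ hs ih =>
    obtain ⟨κ, hκ, t, ht, i, j, hK, rfl, rfl⟩ := hs
    refine subset_trans ?_ ih
    by_cases hj : j = i
    · rw [hj]
    · have := hcol.1 κ hκ t ht j (by simpa [hK] using hj)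
      simpa [hK] using this

open Classical in
/-- The sets of positions of a tuple `b` whose entries are determined by a tuple of a relation. -/
def OpenStr.determinedPositions (Ks : Set (KeyConstraint L)) {m : ℕ} (B : OpenStr L m) :
    Set (Finset (Fin m)) :=
  {I | ∃ (n : ℕ) (R : L.Relations n), ∃ t ∈ B.rel R,
    I = Finset.univ.filter fun i => B.tuple i ∈ B.determinedBy Ks t}

theorem OpenStr.exists_mem_determinedPositions (Ks : Set (KeyConstraint L)) {m : ℕ}
    (B : OpenStr L m) (i : Fin m) : ∃ I ∈ B.determinedPositions Ks, i ∈ I := by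
  obtain ⟨n, R, t, ht, j, hj⟩ := B.no_isolated (B.tuple i)
  refine ⟨_, ⟨n, R, t, ht, rfl⟩, ?_⟩
  simp only [Finset.mem_filter, Finset.mem_univ, true_and]
  exact ⟨j, by rw [hj]⟩

theorem mem_rel_ncard_le [Finite (Σ n, L.Relations n)] (D : FinStr L) {n : ℕ} (R : L.Relations n) :
    (D.rel R).ncard ≤ D.maxRelSize :=
  le_ciSup (f := fun R : (Σ n, L.Relations n) => (D.rel R.2).ncard) (Set.finite_range _).bddAbove
    ⟨n, R⟩

/-- Upper bound for the number of images of the tuple by the maximum fractional packing. -/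
theorem OpenStr.ncard_homs_le [Finite (Σ n, L.Relations n)] {m : ℕ} (B : OpenStr L m)
    {d : ℝ} (hd : ∀ w, IsFractionalPacking (B.determinedPositions Ks) w → ∑ i, w i ≤ d)
    {D : FinStr L} (hD : D.Satisfies Ks) :
    ((B.homs D).ncard : ℝ) ≤ ((max D.maxRelSize 2 : ℕ) : ℝ) ^ d := by
  classical
  have hfin : (B.homs D).Finite := Set.toFinite _
  let _ := hfin.fintype
  rcases (B.homs D).eq_empty_or_nonempty with he | hn
  · rw [he, Set.ncard_empty, Nat.cast_zero]
    positivity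
  have : Nonempty (B.homs D) := hn.to_subtype
  -- The 2 keeps `Real.log M` positive.
  set M : ℕ := max D.maxRelSize 2 with hM
  have hM2 : (2 : ℝ) ≤ M := by exact_mod_cast le_max_right D.maxRelSize 2
  have hlog : 0 < Real.log M := Real.log_pos (by linarith)
  obtain ⟨w, hw0, hws, hwI⟩ := exists_entropy_weights
    (fun (i : Fin m) (ω : B.homs D) => ω.1 i) fun ω ω' h => Subtype.ext (funext h)
  choose f hf using fun ω : B.homs D => ω.2
  have hpack : IsFractionalPacking (B.determinedPositions Ks) fun i => w i / Real.log M := by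
    refine ⟨fun i => div_nonneg (hw0 i) hlog.le, ?_⟩
    rintro I ⟨n, R, t, ht, rfl⟩
    rw [← Finset.sum_div, div_le_one hlog]
    refine (hwI _).trans ?_
    have hfR : (D.rel R).Finite := Set.toFinite _
    have hmem : ∀ ω, f ω ∘ t ∈ D.rel R := fun ω => (f ω).map_rel' R t ht
    -- The image of `t` in `D.rel R` fixes every entry of `ω` at a position determined by `t`.
    refine (coordEntropy_le_log_card _ (fun ω => f ω ∘ t) hfR.toFinset (fun ω => by
      simpa using hmem ω) ?_).trans ?_
    · intro ω ω' hωω' i hi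
      simp only [Finset.mem_filter, Finset.mem_univ, true_and] at hi
      obtain ⟨j, hj⟩ := hi
      have := FinStr.Determines.hom_eq hD hj (f ω) (f ω') (congrFun hωω' j)
      rw [hf ω, hf ω']
      exact this
    · rw [← Set.ncard_eq_toFinset_card _ hfR]
      obtain ⟨ω⟩ := ‹Nonempty (B.homs D)›
      refine Real.log_le_log ?_ ?_
      · exact_mod_cast (Set.ncard_pos hfR).2 ⟨_, hmem ω⟩
      · exact_mod_cast (mem_rel_ncard_le D R).trans (le_max_left _ _)
  have h1 := hd _ hpack
  rw [← Finset.sum_div, hws, div_le_iff₀ hlog, ← Nat.card_eq_fintype_card,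
    Nat.card_coe_set_eq] at h1
  have hpos : (0 : ℝ) < (B.homs D).ncard := by exact_mod_cast (Set.ncard_pos hfin).2 hn
  rw [← Real.log_rpow (by linarith)] at h1
  exact (Real.log_le_log_iff hpos (by positivity)).1 h1

end Determination

/-! ### The color number as the packing optimum. -/

section ColorNumber

variable {L : FirstOrder.Language.{u, v}} {Ks : Set (KeyConstraint L)}

theorem numColors_le {α : Type} {k : ℕ} (col : α → Finset (Fin k)) (S : Set α) :
    numColors col S ≤ k := by
  have := Set.ncard_le_card (⋃ x ∈ S, (col x : Set (Fin k)))
  rwa [Nat.card_eq_fintype_card, Fintype.card_fin] at this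

theorem exists_isGreatest_tupleColorCounts {B : FinStr L} {k : ℕ}
    (col : B.carrier → Finset (Fin k)) (h : (tupleColorCounts B col).Nonempty) :
    ∃ c, IsGreatest (tupleColorCounts B col) c := by
  have hb : BddAbove (tupleColorCounts B col) := ⟨k, by
    rintro c ⟨n, R, t, -, rfl⟩
    exact numColors_le _ _⟩
  exact ⟨_, Nat.sSup_mem h hb, fun c hc => le_csSup hb hc⟩

theorem OpenStr.one_le_of_isGreatest {m : ℕ} {B : OpenStr L m} {k : ℕ}
    {col : B.carrier → Finset (Fin k)} (hcol : IsValidColoring Ks B.toFinStr col) {c : ℕ}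
    (hc : IsGreatest (tupleColorCounts B.toFinStr col) c) : 1 ≤ c := by
  obtain ⟨x, a, ha⟩ := hcol.2
  obtain ⟨n, R, t, ht, hx⟩ := B.no_isolated x
  refine le_trans ?_ (hc.2 ⟨n, R, t, ht, rfl⟩)
  refine (Set.ncard_pos (Set.toFinite _)).2 ⟨a, ?_⟩
  simp only [Set.mem_iUnion]
  exact ⟨x, hx, ha⟩

/-- The ratio of a valid coloring is the total weight of a fractional packing. -/
theorem OpenStr.exists_packing_of_coloring {m : ℕ} {B : OpenStr L m} {k : ℕ}
    {col : B.carrier → Finset (Fin k)} (hcol : IsValidColoring Ks B.toFinStr col) {c : ℕ}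
    (hc : IsGreatest (tupleColorCounts B.toFinStr col) c) :
    ∃ w, IsFractionalPacking (B.determinedPositions Ks) w ∧
      ∑ i, w i = (numColors col (Set.range B.tuple) : ℝ) / c := by
  classical
  have hc1 : (1 : ℝ) ≤ c := by exact_mod_cast B.one_le_of_isGreatest hcol hc
  have hfin : (⋃ x ∈ Set.range B.tuple, (col x : Set (Fin k))).Finite := Set.toFinite _
  set U := hfin.toFinset with hU
  have hex : ∀ a ∈ U, ∃ i, a ∈ col (B.tuple i) := fun a ha => by
    simpa [hU] using ha
  have hcard : numColors col (Set.range B.tuple) = U.card := Set.ncard_eq_toFinset_card _ hfin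
  rcases U.eq_empty_or_nonempty with h0 | ⟨a, ha⟩
  · exact ⟨0, ⟨fun _ => le_rfl, fun I _ => by simp⟩, by simp [hcard, h0]⟩
  have : Nonempty (Fin m) := ⟨(hex a ha).choose⟩
  -- `g` charges each output color to a single position carrying it, so no color is counted twice.
  choose! g hg using hex
  refine ⟨fun i => ((U.filter fun a => g a = i).card : ℝ) / c, ⟨fun i => by positivity, ?_⟩, ?_⟩
  · rintro I ⟨n, R, t, ht, rfl⟩
    rw [← Finset.sum_div, div_le_one (by linarith), ← Nat.cast_sum, Nat.cast_le]
    refine le_trans ?_ (hc.2 ⟨n, R, t, ht, rfl⟩)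
    rw [← Finset.card_biUnion]
    · rw [numColors, ← Set.ncard_coe_finset]
      refine Set.ncard_le_ncard (fun a ha => ?_) (Set.toFinite _)
      simp only [Finset.coe_biUnion, Set.mem_iUnion, Finset.mem_coe, Finset.mem_filter,
        Finset.mem_univ, true_and] at ha ⊢
      obtain ⟨i, ⟨j, hj⟩, haU, rfl⟩ := ha
      exact ⟨t j, ⟨j, rfl⟩, hcol.subset hj (hg a haU)⟩
    · intro i _ j _ hij
      rw [Function.onFun, Finset.disjoint_left]
      intro a ha hb
      simp only [Finset.mem_filter] at ha hb
      exact hij (ha.2.symm.trans hb.2)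
  · rw [← Finset.sum_div, ← Nat.cast_sum,
      ← Finset.card_eq_sum_card_fiberwise (f := g) fun a _ => Finset.mem_coe.2 (Finset.mem_univ _),
      hcard]

/-- The maximum total weight of a fractional packing is the color number. -/
theorem OpenStr.isColorNumber_of_max_packing (hKs : ∀ κ ∈ Ks, κ.IsUnary) {m : ℕ} (B : OpenStr L m)
    (hne : Nonempty B.carrier) (q : Fin m → ℚ)
    (hq : IsFractionalPacking (B.determinedPositions Ks) fun i => (q i : ℝ))
    (hmax : ∀ w, IsFractionalPacking (B.determinedPositions Ks) w →
      ∑ i, w i ≤ ((∑ i, q i : ℚ) : ℝ)) :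
    IsColorNumber Ks B.toFinStr (Set.range B.tuple) (∑ i, q i) := by
  classical
  have hub : ∀ r ∈ colorRatios Ks B.toFinStr (Set.range B.tuple), r ≤ ∑ i, q i := by
    rintro r ⟨k, col, c, -, hcol, hc, rfl⟩
    obtain ⟨w, hw, hs⟩ := B.exists_packing_of_coloring hcol hc
    have := hmax w hw
    rw [hs] at this
    rw [← Rat.cast_le (K := ℝ)]
    simpa only [Rat.cast_div, Rat.cast_natCast] using this
  have hcounts : ∀ {k : ℕ} (col : B.carrier → Finset (Fin k)),
      (tupleColorCounts B.toFinStr col).Nonempty := fun col => by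
    obtain ⟨x⟩ := hne
    obtain ⟨n, R, t, ht, -⟩ := B.no_isolated x
    exact ⟨_, n, R, t, ht, rfl⟩
  have hq0 : ∀ i, 0 ≤ q i := fun i => Rat.cast_nonneg.1 (hq.1 i)
  refine ⟨?_, hub⟩
  suffices h : ∃ r ∈ colorRatios Ks B.toFinStr (Set.range B.tuple), ∑ i, q i ≤ r by
    obtain ⟨r, hr, hle⟩ := h
    rwa [le_antisymm hle (hub r hr)]
  -- When the optimum is 0, clearing denominators would yield no colors; a constant one-color
  -- coloring is valid and suffices.
  rcases (Finset.sum_nonneg fun i _ => hq0 i).eq_or_lt' with h0 | hpos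
  · let col : B.carrier → Finset (Fin 1) := fun _ => Finset.univ
    obtain ⟨c, hc⟩ := exists_isGreatest_tupleColorCounts (B := B.toFinStr) col (hcounts col)
    refine ⟨_, ⟨1, col, c, one_pos, ⟨fun κ hκ t _ i _ => ?_, ?_⟩, hc, rfl⟩, ?_⟩
    · obtain ⟨j, hj⟩ := hKs κ hκ
      simp [hj, col]
    · obtain ⟨x⟩ := hne
      exact ⟨x, by simp [col]⟩
    · rw [h0]
      positivity
  · let N : ℕ := ∏ i, (q i).den
    have hN : 0 < N := Finset.prod_pos fun i _ => (q i).den_pos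
    have hnum : ∀ i, ∃ a : ℕ, (a : ℚ) = N * q i := fun i => by
      obtain ⟨b, hb⟩ := Finset.dvd_prod_of_mem (fun i => (q i).den) (Finset.mem_univ i)
      refine ⟨b * (q i).num.toNat, ?_⟩
      have h1 : (((q i).num.toNat : ℤ) : ℚ) = (q i).num := by
        rw [Int.toNat_of_nonneg (Rat.num_nonneg.2 (hq0 i))]
      have h2 : (N : ℚ) = (q i).den * b := by exact_mod_cast hb
      rw [Nat.cast_mul, h2, ← Int.cast_natCast (R := ℚ) (q i).num.toNat, h1]
      conv_rhs => rw [← Rat.num_div_den (q i)]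
      have : ((q i).den : ℚ) ≠ 0 := by exact_mod_cast (q i).den_pos.ne'
      field_simp
      simp [Rat.num_div_den]
    choose a ha using hnum
    let e := Fintype.equivFin (Σ i : Fin m, Fin (a i))
    set k := Fintype.card (Σ i : Fin m, Fin (a i)) with hk
    have hkq : (k : ℚ) = N * ∑ i, q i := by
      rw [hk, Fintype.card_sigma, Nat.cast_sum, Finset.mul_sum]
      exact Finset.sum_congr rfl fun i _ => by rw [Fintype.card_fin, ha]
    have hk0 : 0 < k := by
      have : (0 : ℚ) < k := by rw [hkq]; positivity
      exact_mod_cast this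
    -- Position `i` owns `a i = N * q i` colors; an element receives the colors of all positions it
    -- determines, which makes the coloring valid.
    let col : B.carrier → Finset (Fin k) := fun x => Finset.univ.filter fun z =>
      Relation.ReflTransGen (B.toFinStr.Determines Ks) x (B.tuple (e.symm z).1)
    obtain ⟨c, hc⟩ := exists_isGreatest_tupleColorCounts (B := B.toFinStr) col (hcounts col)
    have hvalid : IsValidColoring Ks B.toFinStr col := by
      refine ⟨fun κ hκ t ht i _ => ?_, ?_⟩
      · obtain ⟨j, hj⟩ := hKs κ hκ
        rw [hj, Finset.singleton_biUnion]
        intro z hz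
        simp only [col, Finset.mem_filter, Finset.mem_univ, true_and] at hz ⊢
        exact .head ⟨κ, hκ, t, ht, j, i, hj, rfl, rfl⟩ hz
      · refine ⟨B.tuple (e.symm ⟨0, hk0⟩).1, ⟨0, hk0⟩, ?_⟩
        simp only [col, Finset.mem_filter, Finset.mem_univ, true_and]
        exact .refl
    have hc1 : 1 ≤ c := B.one_le_of_isGreatest hvalid hc
    have hall : numColors col (Set.range B.tuple) = k := by
      have : (⋃ x ∈ Set.range B.tuple, (col x : Set (Fin k))) = Set.univ := by
        refine Set.eq_univ_of_forall fun z => ?_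
        simp only [Set.mem_iUnion]
        refine ⟨_, ⟨(e.symm z).1, rfl⟩, ?_⟩
        simp only [col, Finset.coe_filter, Finset.mem_univ, true_and, Set.mem_ofPred_eq]
        exact .refl
      rw [numColors, this, Set.ncard_univ, Nat.card_eq_fintype_card, Fintype.card_fin]
    -- A tuple only sees colors owned by the positions it determines, whose packing weight is at
    -- most 1.
    have hcN : c ≤ N := by
      obtain ⟨n, R, t, ht, rfl⟩ := hc.1
      have hI := hq.2 _ ⟨n, R, t, ht, rfl⟩
      set I : Finset (Fin m) := Finset.univ.filter fun i => B.tuple i ∈ B.determinedBy Ks t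
      have hsub : (⋃ x ∈ Set.range t, (col x : Set (Fin k))) ⊆
          ((I.sigma fun i => (Finset.univ : Finset (Fin (a i)))).map e.toEmbedding :) := by
        intro z hz
        simp only [Set.mem_iUnion] at hz
        obtain ⟨_, ⟨j, rfl⟩, hz⟩ := hz
        simp only [col, Finset.coe_filter, Finset.mem_univ, true_and, Set.mem_ofPred_eq] at hz
        rw [Finset.mem_coe, Finset.mem_map_equiv, Finset.mem_sigma]
        refine ⟨?_, Finset.mem_univ _⟩
        simp only [I, Finset.mem_filter, Finset.mem_univ, true_and]
        exact ⟨j, hz⟩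
      have hle := Set.ncard_le_ncard hsub (Set.toFinite _)
      rw [Set.ncard_coe_finset, Finset.card_map, Finset.card_sigma] at hle
      refine hle.trans ?_
      simp only [Finset.card_univ, Fintype.card_fin]
      have hI' : ∑ i ∈ I, q i ≤ 1 := by
        rw [← Rat.cast_le (K := ℝ)]
        simpa only [Rat.cast_sum, Rat.cast_one] using hI
      have : ((∑ i ∈ I, a i : ℕ) : ℚ) ≤ N := by
        rw [Nat.cast_sum, Finset.sum_congr rfl fun i _ => ha i, ← Finset.mul_sum]
        exact mul_le_of_le_one_right (Nat.cast_nonneg _) hI'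
      exact_mod_cast this
    refine ⟨_, ⟨k, col, c, hk0, hvalid, hc, rfl⟩, ?_⟩
    rw [hall, hkq, le_div_iff₀ (by exact_mod_cast hc1), mul_comm]
    exact mul_le_mul_of_nonneg_right (by exact_mod_cast hcN) hpos.le

end ColorNumber

/-! ### Structures with large output, built from a coloring. -/

section ColoredPower

/-- The number of values of a map that depends exactly on the coordinates in `U`. -/
theorem ncard_range_of_eq_iff {ι β γ : Type*} [Finite ι] [Nonempty β] (U : Set ι)
    (F : (ι → β) → γ) (hF : ∀ f g, F f = F g ↔ ∀ c ∈ U, f c = g c) :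
    (Set.range F).ncard = Nat.card β ^ U.ncard := by
  classical
  obtain ⟨b⟩ := ‹Nonempty β›
  let G : (U → β) → γ := fun g => F fun c => if h : c ∈ U then g ⟨c, h⟩ else b
  have hG : Function.Injective G := fun g g' h => by
    funext c
    have := (hF _ _).1 h c.1 c.2
    simpa using this
  have hr : Set.range F = Set.range G := by
    refine subset_antisymm ?_ (Set.range_subset_iff.2 fun g => ⟨_, rfl⟩)
    rintro _ ⟨f, rfl⟩
    exact ⟨fun c => f c, (hF _ _).2 fun c hc => by simp [hc]⟩
  rw [hr, ← Set.image_univ, Set.ncard_image_of_injective _ hG, Set.ncard_univ, Nat.card_fun,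
    Nat.card_coe_set_eq]

variable {α : Type} {k : ℕ}

/-- The assignment `f`, with the colors outside of `s` reset to the value `0`. -/
def maskColors {N : ℕ} (s : Finset (Fin k)) (f : Fin k → Fin (N + 1)) : Fin k → Fin (N + 1) :=
  fun c => if c ∈ s then f c else 0

theorem maskColors_eq_iff {N : ℕ} {s : Finset (Fin k)} {f g : Fin k → Fin (N + 1)} :
    maskColors s f = maskColors s g ↔ ∀ c ∈ s, f c = g c := by
  constructor
  · intro h c hc
    simpa [maskColors, hc] using congrFun h c
  · intro h
    funext c
    by_cases hc : c ∈ s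
    · simp [maskColors, hc, h c hc]
    · simp [maskColors, hc]

/-- The tuple `t`, whose entries are labelled by the values of `f` at their colors. -/
def coloredTuple (col : α → Finset (Fin k)) {N n : ℕ} (t : Fin n → α) (f : Fin k → Fin (N + 1)) :
    Fin n → α × (Fin k → Fin (N + 1)) :=
  fun i => (t i, maskColors (col (t i)) f)

theorem ncard_range_coloredTuple (col : α → Finset (Fin k)) (N : ℕ) {n : ℕ} (t : Fin n → α) :
    (Set.range (coloredTuple (N := N) col t)).ncard = (N + 1) ^ numColors col (Set.range t) := by
  rw [ncard_range_of_eq_iff (⋃ x ∈ Set.range t, (col x : Set (Fin k))) (coloredTuple col t),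
    Nat.card_eq_fintype_card, Fintype.card_fin, numColors]
  intro f g
  constructor
  · rintro h c hc
    simp only [Set.mem_iUnion] at hc
    obtain ⟨_, ⟨i, rfl⟩, hc⟩ := hc
    exact maskColors_eq_iff.1 (congrArg Prod.snd (congrFun h i)) c hc
  · refine fun h => funext fun i => Prod.ext rfl (maskColors_eq_iff.2 fun c hc => h c ?_)
    simp only [Set.mem_iUnion]
    exact ⟨_, ⟨i, rfl⟩, hc⟩

variable {L : FirstOrder.Language.{u, v}} [L.IsRelational] {Ks : Set (KeyConstraint L)}

/-- The structure whose tuples are the tuples of `B`, labelled by all assignments of `N + 1`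
values to the colors. -/
def FinStr.coloredPower (B : FinStr L) (col : B.carrier → Finset (Fin k)) (N : ℕ) : FinStr L where
  carrier := B.carrier × (Fin k → Fin (N + 1))
  str :=
    { funMap := fun f => isEmptyElim f
      RelMap := fun R s => ∃ t ∈ B.rel R, ∃ f, s = coloredTuple col t f }

/-- Equal key entries share the underlying tuple, as `B` satisfies the keys, and the values on the
key entry's colors, which by validity include all colors of the tuple. -/
theorem FinStr.coloredPower_satisfies (hKs : ∀ κ ∈ Ks, κ.IsUnary) {B : FinStr L}
    (hB : B.Satisfies Ks) {col : B.carrier → Finset (Fin k)} (hcol : IsValidColoring Ks B col)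
    (N : ℕ) : (B.coloredPower col N).Satisfies Ks := by
  rintro κ hκ _ ⟨t, ht, f, rfl⟩ _ ⟨t', ht', f', rfl⟩ h
  obtain ⟨i, hi⟩ := hKs κ hκ
  have hi' := h i (by simp [hi])
  obtain rfl : t = t' := hB κ hκ t ht t' ht' fun j hj => congrArg Prod.fst (h j hj)
  have hm := maskColors_eq_iff.1 (congrArg Prod.snd hi')
  funext j
  refine Prod.ext rfl (maskColors_eq_iff.2 fun c hc => hm c ?_)
  by_cases hj : j = i
  · rwa [hj] at hc
  · have := hcol.1 κ hκ t ht j (by simpa [hi] using hj) hc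
    simpa [hi] using this

theorem FinStr.ncard_rel_coloredPower_le (B : FinStr L) (col : B.carrier → Finset (Fin k)) (N : ℕ)
    {c : ℕ} (hc : c ∈ upperBounds (tupleColorCounts B col)) {n : ℕ} (R : L.Relations n) :
    ((B.coloredPower col N).rel R).ncard ≤ (B.rel R).ncard * (N + 1) ^ c := by
  classical
  have hfin : (B.rel R).Finite := Set.toFinite _
  let Q : Set (Fin n → B.carrier × (Fin k → Fin (N + 1))) := (B.coloredPower col N).rel R
  change Q.ncard ≤ _
  have h1 : Q = ⋃ t ∈ hfin.toFinset, Set.range (coloredTuple (N := N) col t) := by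
    ext s
    simp only [Set.mem_iUnion, Set.Finite.mem_toFinset, exists_prop]
    exact ⟨fun ⟨t, ht, f, h⟩ => ⟨t, ht, f, h.symm⟩, fun ⟨t, ht, f, h⟩ => ⟨t, ht, f, h.symm⟩⟩
  rw [h1, Set.ncard_eq_toFinset_card _ hfin, ← smul_eq_mul]
  refine (Finset.set_ncard_biUnion_le _ _).trans (Finset.sum_le_card_nsmul _ _ _ fun t ht => ?_)
  rw [ncard_range_coloredTuple]
  exact Nat.pow_le_pow_right N.succ_pos (hc ⟨n, R, t, by simpa using ht, rfl⟩)

theorem FinStr.maxRelSize_coloredPower_le [Finite (Σ n, L.Relations n)] (B : FinStr L)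
    (col : B.carrier → Finset (Fin k)) (N : ℕ) {c : ℕ} (hc : IsGreatest (tupleColorCounts B col) c) :
    (B.coloredPower col N).maxRelSize ≤ B.maxRelSize * (N + 1) ^ c := by
  obtain ⟨n, R, -⟩ := hc.1
  have : Nonempty (Σ n, L.Relations n) := ⟨⟨n, R⟩⟩
  exact ciSup_le fun R => (B.ncard_rel_coloredPower_le col N hc.2 R.2).trans
    (Nat.mul_le_mul_right _ (mem_rel_ncard_le B R.2))

theorem FinStr.le_maxRelSize_coloredPower [Finite (Σ n, L.Relations n)] (B : FinStr L)
    (col : B.carrier → Finset (Fin k)) (N : ℕ) {c : ℕ} (hc : c ∈ tupleColorCounts B col) :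
    (N + 1) ^ c ≤ (B.coloredPower col N).maxRelSize := by
  obtain ⟨n, R, t, ht, rfl⟩ := hc
  rw [← ncard_range_coloredTuple]
  have : Finite (B.carrier × (Fin k → Fin (N + 1))) := (B.coloredPower col N).fin
  refine (Set.ncard_le_ncard ?_ (Set.toFinite _)).trans
    (mem_rel_ncard_le (B.coloredPower col N) R :)
  rintro _ ⟨f, rfl⟩
  exact ⟨t, ht, f, rfl⟩

/-- Each assignment `f` of values to colors gives a homomorphism labelling every element by its own
colors' values. -/
theorem OpenStr.le_ncard_homs_coloredPower {m : ℕ} (B : OpenStr L m)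
    (col : B.carrier → Finset (Fin k)) (N : ℕ) :
    (N + 1) ^ numColors col (Set.range B.tuple) ≤ (B.homs (B.coloredPower col N)).ncard := by
  rw [← ncard_range_coloredTuple]
  have : Finite (B.carrier × (Fin k → Fin (N + 1))) := (B.coloredPower col N).fin
  refine Set.ncard_le_ncard ?_ (Set.toFinite _)
  rintro _ ⟨f, rfl⟩
  exact ⟨⟨fun x => (x, maskColors (col x) f), fun g => isEmptyElim g,
    fun R t ht => ⟨t, ht, f, rfl⟩⟩, rfl⟩

end ColoredPower

/-! ### Comparison of growth rates and the main theorem. -/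

/-- A growth bound of exponent `e` along arguments between `n ^ c` and `r * n ^ c` does not allow
values of at least `n ^ a` if `c * e < a`. -/
theorem not_isBigO_of_pow_le {h : ℕ → ℕ} {e : ℝ}
    (hO : (fun M : ℕ => (h M : ℝ)) =O[atTop] fun M : ℕ => (M : ℝ) ^ e) {a c r : ℕ} (hc : 1 ≤ c)
    (hr : 1 ≤ r) (M : ℕ → ℕ) (h1 : ∀ N, (N + 1) ^ c ≤ M N) (h2 : ∀ N, M N ≤ r * (N + 1) ^ c)
    (h3 : ∀ N, (N + 1) ^ a ≤ h (M N)) : (a : ℝ) ≤ c * e := by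
  by_contra! hlt
  obtain ⟨C, hC0, hC⟩ := hO.exists_pos
  have hM : Tendsto M atTop atTop := tendsto_atTop_mono
    (fun N => ((Nat.le_succ N).trans (Nat.le_self_pow (by omega) _)).trans (h1 N)) tendsto_id
  have hbound : ∀ᶠ N : ℕ in atTop, ((N + 1 : ℕ) : ℝ) ^ ((a : ℝ) - c * e) ≤ C * max 1 ((r : ℝ) ^ e) := by
    filter_upwards [hM.eventually hC.bound] with N hN
    have hn : (0 : ℝ) < ((N + 1 : ℕ) : ℝ) := by positivity
    have hMN : (0 : ℝ) < M N := by
      exact_mod_cast (Nat.pow_pos N.succ_pos).trans_le (h1 N)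
    have h1' : ((N + 1 : ℕ) : ℝ) ^ (c : ℝ) ≤ M N := by
      rw [Real.rpow_natCast]; exact_mod_cast h1 N
    have h2' : (M N : ℝ) ≤ r * ((N + 1 : ℕ) : ℝ) ^ (c : ℝ) := by
      rw [Real.rpow_natCast]; exact_mod_cast h2 N
    have h3' : ((N + 1 : ℕ) : ℝ) ^ (a : ℝ) ≤ h (M N) := by
      rw [Real.rpow_natCast]; exact_mod_cast h3 N
    have hMe : (M N : ℝ) ^ e ≤ max 1 ((r : ℝ) ^ e) * ((N + 1 : ℕ) : ℝ) ^ (c * e) := by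
      rw [Real.rpow_mul hn.le]
      -- The exponent may be negative, and then the lower bound on `M N` is the one needed.
      rcases le_total 0 e with he | he
      · calc (M N : ℝ) ^ e ≤ (r * ((N + 1 : ℕ) : ℝ) ^ (c : ℝ)) ^ e :=
              Real.rpow_le_rpow hMN.le h2' he
          _ = (r : ℝ) ^ e * (((N + 1 : ℕ) : ℝ) ^ (c : ℝ)) ^ e :=
              Real.mul_rpow (by positivity) (by positivity)
          _ ≤ _ := mul_le_mul_of_nonneg_right (le_max_right _ _) (by positivity)
      · calc (M N : ℝ) ^ e ≤ (((N + 1 : ℕ) : ℝ) ^ (c : ℝ)) ^ e :=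
              Real.rpow_le_rpow_of_nonpos (by positivity) h1' he
          _ ≤ _ := le_mul_of_one_le_left (by positivity) (le_max_left _ _)
    rw [Real.norm_of_nonneg (Nat.cast_nonneg _), Real.norm_of_nonneg (by positivity)] at hN
    rw [Real.rpow_sub hn, div_le_iff₀ (by positivity), mul_assoc]
    exact h3'.trans (hN.trans (mul_le_mul_of_nonneg_left hMe hC0.le))
  have htend : Tendsto (fun N : ℕ => ((N + 1 : ℕ) : ℝ) ^ ((a : ℝ) - c * e)) atTop atTop :=
    (tendsto_rpow_atTop (sub_pos.2 hlt)).comp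
      (tendsto_natCast_atTop_atTop.comp (tendsto_add_atTop_nat 1))
  obtain ⟨N, hN1, hN2⟩ := (hbound.and (htend.eventually_gt_atTop _)).exists
  exact absurd hN1 (not_le.2 hN2)

theorem mainTheorem5 (L : FirstOrder.Language.{u, v}) [L.IsRelational] [Finite (Σ n, L.Relations n)]
    (Ks : Set (KeyConstraint L)) (hKs : ∀ κ ∈ Ks, κ.IsUnary)
    {m : ℕ} (p : SPJPlan L m) (A B : OpenStr L m) (hA : p.IsRepresentation A)
    (hne : Nonempty A.carrier) (hB : IsChase Ks A B) :
    ∃ d : ℚ, IsColorNumber Ks B.toFinStr (Set.range B.tuple) d ∧ p.HasOutputDegree Ks d := by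
  obtain ⟨q, hq, hmax⟩ := exists_rat_max_fractionalPacking (B.determinedPositions Ks)
    (B.exists_mem_determinedPositions Ks)
  have hcn := B.isColorNumber_of_max_packing hKs (hB.nonempty hne) q hq hmax
  have hout : ∀ D : FinStr L, D.Satisfies Ks → p.out D = B.homs D := fun D hD =>
    (hA D).trans (hB.homs_eq hD)
  set d : ℚ := ∑ i, q i
  refine ⟨d, hcn, ⟨fun M => ⌊((max M 2 : ℕ) : ℝ) ^ (d : ℝ)⌋₊, ?_, fun D hD => ?_⟩, ?_⟩
  · refine IsBigO.of_bound 1 ?_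
    filter_upwards [eventually_ge_atTop 2] with M hM
    rw [max_eq_left hM, one_mul, Real.norm_of_nonneg (Nat.cast_nonneg _),
      Real.norm_of_nonneg (by positivity)]
    exact Nat.floor_le (by positivity)
  · rw [hout D hD]
    exact Nat.le_floor (B.ncard_homs_le hmax hD)
  · rintro ε hε ⟨h, hO, hle⟩
    obtain ⟨k, col, c, -, hcol, hc, hd⟩ := hcn.1
    have hc1 : 1 ≤ c := B.one_le_of_isGreatest hcol hc
    have hr : 1 ≤ B.maxRelSize := by
      obtain ⟨n, R, t, ht, -⟩ := hc.1
      exact ((Set.ncard_pos (Set.toFinite _)).2 ⟨t, ht⟩).trans_le (mem_rel_ncard_le B.toFinStr R)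
    -- For an optimal coloring the number of output colors equals `c * d`, so the resulting bound by
    -- `c * (d - ε)` is contradictory.
    have hbound := not_isBigO_of_pow_le hO (a := numColors col (Set.range B.tuple)) hc1 hr
      (fun N => (B.coloredPower col N).maxRelSize)
      (fun N => B.le_maxRelSize_coloredPower col N hc.1)
      (fun N => B.maxRelSize_coloredPower_le col N hc) fun N => by
        have hD := FinStr.coloredPower_satisfies hKs hB.satisfies hcol N
        have := hle _ hD
        rw [hout _ hD] at this
        exact (B.le_ncard_homs_coloredPower col N).trans this
    have hc0 : (0 : ℚ) < c := by exact_mod_cast hc1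
    have hb : (numColors col (Set.range B.tuple) : ℚ) ≤ c * (d - ε) := by exact_mod_cast hbound
    rw [eq_div_iff hc0.ne'] at hd
    nlinarith
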